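/- Let $(a_n)_{n\ge 0}$ be a sequence of positive real numbers and $(b_n)_{n\ge 0}$ a sequence of real numbers. For $n\ge 1$ and $x\in\mathbb R$ put $$B_n(x)=\begin{pmatrix}0&1\\-\frac{a_{n-1}}{a_n}&\frac{x-b_n}{a_n}\end{pmatrix}.$$ Let $N$ and $r$ be positive integers and $i\in\{0,1,\dots,N-1\}$, and put $$X_n(x)=B_{n+N-1}(x)\cdots B_{n+1}(x)B_n(x),\qquad n\ge 1.$$ For $\alpha=(\alpha_0,\alpha_1)\in\mathbb R^2\setminus\{0\}$ and $x\in\mathbb R$ let $(u_n)_{n\ge 0}$ be the unique solution of $a_{n-1}u_{n-1}+b_nu_n+a_nu_{n+1}=xu_n$, $n\ge 1$, with $(u_0,u_1)=\alpha$, and define the generalized $N$-shifted Turán determinants $$S_n(\alpha,x)=a_{n+N-1}\big(u_nu_{n+N-1}-u_{n-1}u_{n+N}\big),\qquad n\ge 1.$$ For a compact set $K\subset\mathbb R$, a sequence $(Y_k)_{k\ge 1}$ of continuous maps $K\to \mathrm{GL}(2,\mathbb R)$ is said to belong to $\mathcal D_{r,0}(K,\mathrm{GL}(2,\mathbb R))$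 if $\sup_{k\ge 1}\sup_{x\in K}\|Y_k(x)\|<\infty$ and, for each $j\in\{1,\dots,r\}$, $$\sum_{k\ge 1}\ \sup_{x\in K}\|\Delta^jY_k(x)\|^{r/j}<\infty,$$ where $\Delta^0Y_k=Y_k$ and $\Delta^jY_k=\Delta^{j-1}Y_{k+1}-\Delta^{j-1}Y_k$. Write $\operatorname{discr}X=(\operatorname{tr}X)^2-4\det X$ for a $2\times 2$ matrix $X$. Let $K$ be a compact subset of $$\Lambda=\Big\{x\in\mathbb R:\ \lim_{k\to\infty}\operatorname{discr}\big(X_{kN+i}(x)\big)\text{ exists and is negative}\Big\}.$$ If $$\lim_{k\to\infty}\frac{a_{(k+1)N+i-1}}{a_{kN+i-1}}=1\qquad\text{and}\qquad (X_{kN+i})_{k\ge 1}\in\mathcal D_{r,0}\big(K,\mathrm{GL}(2,\mathbb R)\big),$$ then the sequence of functions $(S_{kN+i}(\alpha,x))_{k\ge 1}$ converges uniformly for $(\alpha,x)\in\mathbb S^1\times K$, where $\mathbb S^1$ is the unit circle in $\mathbb R^2$. -/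

import Mathlib

open Filter Topology
open scoped Matrix.Norms.L2Operator

/-- Iterated forward difference of a sequence in a normed space:
`stolzDiff 0 x = x` and `stolzDiff (j + 1) x n = stolzDiff j x (n + 1) - stolzDiff j x n`. -/
def stolzDiff {E : Type*} [NormedAddCommGroup E] : ℕ → (ℕ → E) → ℕ → E
  | 0, x => x
  | j + 1, x => fun n => stolzDiff j x (n + 1) - stolzDiff j x n

/-- The Stolz class `𝓓_{r,s}(E)` of a normed space `E`, for `0 ≤ s ≤ r - 1`. Sequences are indexed by
the positive integers, so the value of `x` at `0` is not used. -/
structure MemStolz {E : Type*} [NormedAddCommGroup E] (r s : ℕ) (x : ℕ → E) : Prop where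
  bounded : ∃ C : ℝ, ∀ n : ℕ, 1 ≤ n → ‖x n‖ ≤ C
  summable : ∀ j : ℕ, 1 ≤ j → j ≤ r - s →
    Summable fun n : ℕ => ‖stolzDiff j x (n + 1)‖ ^ ((r : ℝ) / ((j : ℝ) + (s : ℝ)))

/-- The class `𝓓_{r,s}(K, GL(2, ℝ))`: the matrix functions `X n`, `n ≥ 1`, have invertible values
on `K`, are continuous on `K`, and form a sequence of class `𝓓_{r,s}` in the space of continuous
maps on `K` with the supremum norm. -/
def MemStolzGL (r s : ℕ) (K : TopologicalSpace.Compacts ℝ)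
    (X : ℕ → ℝ → Matrix (Fin 2) (Fin 2) ℝ) : Prop :=
  ∃ F : ℕ → C(K, Matrix (Fin 2) (Fin 2) ℝ),
    (∀ n : ℕ, 1 ≤ n → ∀ x : K, F n x = X n x ∧ IsUnit (X n x)) ∧ MemStolz r s F

/-- The one-step transfer matrix `B_n(x)`, meaningful for `n ≥ 1`. -/
noncomputable def transferB (a b : ℕ → ℝ) (n : ℕ) (x : ℝ) : Matrix (Fin 2) (Fin 2) ℝ :=
  !![0, 1; -(a (n - 1) / a n), (x - b n) / a n]

/-- The `N`-step transfer matrix `X_n(x) = B_{n+N-1}(x) ⋯ B_{n+1}(x) B_n(x)`. -/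
noncomputable def transferX (a b : ℕ → ℝ) : ℕ → ℕ → ℝ → Matrix (Fin 2) (Fin 2) ℝ
  | 0, _, _ => 1
  | N + 1, n, x => transferB a b (n + N) x * transferX a b N n x

/-- The generalized eigenvector `(u_n)` associated with `x` such that `(u_0, u_1) = α`. -/
noncomputable def genEigvec (a b : ℕ → ℝ) (α : EuclideanSpace ℝ (Fin 2)) (x : ℝ) : ℕ → ℝ
  | 0 => α 0
  | 1 => α 1
  | n + 2 => ((x - b (n + 1)) * genEigvec a b α x (n + 1) - a n * genEigvec a b α x n) / a (n + 1)

/-- `genEigvec a b α x` is the unique solution of the three-term recurrence with initial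
data `α`. -/
theorem eq_genEigvec_iff {a b : ℕ → ℝ} (ha : ∀ n, 0 < a n) (α : EuclideanSpace ℝ (Fin 2)) (x : ℝ)
    (u : ℕ → ℝ) :
    u = genEigvec a b α x ↔ u 0 = α 0 ∧ u 1 = α 1 ∧
      ∀ n : ℕ, 1 ≤ n → a (n - 1) * u (n - 1) + b n * u n + a n * u (n + 1) = x * u n := by
  constructor
  · rintro rfl
    refine ⟨by simp [genEigvec], by simp [genEigvec], ?_⟩
    intro n hn
    obtain ⟨m, rfl⟩ : ∃ m, n = m + 1 := ⟨n - 1, by omega⟩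
    have h := (ha (m + 1)).ne'
    rw [show m + 1 + 1 = m + 2 from rfl, genEigvec, Nat.add_sub_cancel]
    field_simp
    ring
  · rintro ⟨h0, h1, h⟩
    have key : ∀ n, u n = genEigvec a b α x n ∧ u (n + 1) = genEigvec a b α x (n + 1) := by
      intro n
      induction n with
      | zero => exact ⟨by simp [genEigvec, h0], by simp [genEigvec, h1]⟩
      | succ n ih =>
        refine ⟨ih.2, ?_⟩
        have hr := h (n + 1) (by omega)
        rw [Nat.add_sub_cancel] at hr
        rw [show n + 1 + 1 = n + 2 from rfl, genEigvec, ← ih.1, ← ih.2,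
          eq_div_iff (ha (n + 1)).ne']
        linarith
    funext n
    exact (key n).1

/-- The generalized `N`-shifted Turán determinant `S_n(α, x)`, for `N ≥ 1` and `n ≥ 1`. -/
noncomputable def turanDet (a b : ℕ → ℝ) (N n : ℕ) (α : EuclideanSpace ℝ (Fin 2)) (x : ℝ) : ℝ :=
  a (n + N - 1) *
    (genEigvec a b α x n * genEigvec a b α x (n + N - 1) -
      genEigvec a b α x (n - 1) * genEigvec a b α x (n + N))

/-- The set `Λ` of all real `x` for which the limit of `discr X_{kN+i}(x)` as `k → ∞` exists and is
negative. -/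
def turanLambda (a b : ℕ → ℝ) (N i : ℕ) : Set ℝ :=
  {x : ℝ | ∃ l : ℝ, l < 0 ∧
    Tendsto (fun k : ℕ => (transferX a b N (k * N + i) x).discr) atTop (𝓝 l)}

/-! Write the `N`-step matrix as `!![p, q; u, v]` and let `w = (w₁, w₂)` be two consecutive values
of the solution. The Turán determinant is a scalar times the form `q w₂² + (p - v) w₁ w₂ - u w₁²`.
Negative discriminant makes this form definite, equal to `q |w₂ - t₀ w₁|²`, where `t₀` is a non-real
fixed point of the Möbius action `t ↦ (u + t v) / (p + t q)` and `2 q Im t₀ = √(-discr)`.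

If `t` were transported exactly by the Möbius maps, `A |w₂ - t w₁|² / Im t` would be constant,
because `det = A n / A (n + 1)`. The fixed points `t₀` vary with `n`, so they are not transported
exactly. Newton corrections produce a nearby sequence `t` whose residual is `O(b ^ r)`, each
correction spending one difference to gain one power of `b`. The Stolz condition supplies a single
weight `b` with `Δ^j = O(b ^ j)` and `∑ b ^ r < ∞`. Hence the relative increments of the quantity
are summable and it converges uniformly (`conserved_step`, `exists_uniform_limit_conserved`).

Since `t - t₀ = O(b)` tends to zero and the ratios of `A` tend to one, the Turán form differs from
`√(-discr) / 2` times this quantity by `o(1)` (`turan_form_sub_conserved`). The factor converges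
uniformly as well: the discriminants are polynomials of bounded degree, for which pointwise
convergence on a compact set is uniform. -/

/-- `DiffBound b s d f`: the iterated differences `Δ^j f`, `j ≤ d`, are `O(b ^ (s + j))`,
uniformly in the parameter. -/
def DiffBound {X : Type*} (b : ℕ → ℝ) : ℕ → ℕ → (ℕ → X → ℂ) → Prop
  | s, 0, f => ∃ C : ℝ, ∀ n x, ‖f n x‖ ≤ C * b n ^ s
  | s, d + 1, f => (∃ C : ℝ, ∀ n x, ‖f n x‖ ≤ C * b n ^ s) ∧
      DiffBound b (s + 1) d (fun n x => f (n + 1) x - f n x)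

/-! ### Calculus of iterated difference bounds. -/

namespace DiffBound

variable {X : Type*} {b : ℕ → ℝ} {s t d : ℕ} {f g : ℕ → X → ℂ}

theorem bound (h : DiffBound b s d f) : ∃ C : ℝ, ∀ n x, ‖f n x‖ ≤ C * b n ^ s := by
  cases d with
  | zero => exact h
  | succ d => exact h.1

theorem bound_pos (hb : ∀ n, 0 ≤ b n) (h : DiffBound b s d f) :
    ∃ C : ℝ, 0 < C ∧ ∀ n x, ‖f n x‖ ≤ C * b n ^ s := by
  obtain ⟨C, hC⟩ := h.bound
  refine ⟨max C 1, by positivity, fun n x => (hC n x).trans ?_⟩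
  exact mul_le_mul_of_nonneg_right (le_max_left _ _) (pow_nonneg (hb n) s)

theorem pred (h : DiffBound b s (d + 1) f) : DiffBound b s d f := by
  induction d generalizing s f with
  | zero => exact h.1
  | succ d ih => exact ⟨h.1, ih h.2⟩

theorem mono_depth {e : ℕ} (h : DiffBound b s d f) (hed : e ≤ d) : DiffBound b s e f := by
  induction d, hed using Nat.le_induction with
  | base => exact h
  | succ d _ ih => exact ih h.pred

theorem lower {M : ℝ} (hb : ∀ n, 0 ≤ b n) (hM : ∀ n, b n ≤ M) (h : DiffBound b (s + 1) d f) :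
    DiffBound b s d f := by
  have key : ∀ {s : ℕ} {f : ℕ → X → ℂ}, (∃ C : ℝ, ∀ n x, ‖f n x‖ ≤ C * b n ^ (s + 1)) →
      ∃ C : ℝ, ∀ n x, ‖f n x‖ ≤ C * b n ^ s := by
    rintro s f ⟨C, hC⟩
    refine ⟨|C| * M, fun n x => (hC n x).trans ?_⟩
    have h1 := hb n
    calc C * b n ^ (s + 1) ≤ |C| * b n ^ (s + 1) := by gcongr; exact le_abs_self C
      _ = |C| * b n * b n ^ s := by ring
      _ ≤ |C| * M * b n ^ s := by gcongr; exact hM n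
  induction d generalizing s f with
  | zero => exact key h
  | succ d ih => exact ⟨key h.1, ih h.2⟩

theorem mono_weight {M : ℝ} (hb : ∀ n, 0 ≤ b n) (hM : ∀ n, b n ≤ M) (h : DiffBound b t d f)
    (hst : s ≤ t) : DiffBound b s d f := by
  induction t, hst using Nat.le_induction with
  | base => exact h
  | succ t _ ih => exact ih (h.lower hb hM)

theorem add (hf : DiffBound b s d f) (hg : DiffBound b s d g) :
    DiffBound b s d (fun n x => f n x + g n x) := by
  have key : ∀ {s : ℕ} {f g : ℕ → X → ℂ}, (∃ C : ℝ, ∀ n x, ‖f n x‖ ≤ C * b n ^ s) →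
      (∃ C : ℝ, ∀ n x, ‖g n x‖ ≤ C * b n ^ s) →
      ∃ C : ℝ, ∀ n x, ‖f n x + g n x‖ ≤ C * b n ^ s := by
    rintro s f g ⟨C, hC⟩ ⟨C', hC'⟩
    refine ⟨C + C', fun n x => (norm_add_le _ _).trans ?_⟩
    rw [add_mul]
    exact add_le_add (hC n x) (hC' n x)
  induction d generalizing s f g with
  | zero => exact key hf hg
  | succ d ih =>
    refine ⟨key hf.1 hg.1, ?_⟩
    convert ih hf.2 hg.2 using 3
    ring

theorem neg (hf : DiffBound b s d f) : DiffBound b s d (fun n x => -f n x) := by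
  induction d generalizing s f with
  | zero => simpa [DiffBound] using hf
  | succ d ih =>
    refine ⟨by simpa using hf.1, ?_⟩
    convert ih hf.2 using 3
    ring

theorem sub (hf : DiffBound b s d f) (hg : DiffBound b s d g) :
    DiffBound b s d (fun n x => f n x - g n x) := by
  simpa only [sub_eq_add_neg] using hf.add hg.neg

/-- From `f (n + 1) = f n + Δf n`: the bound stays in terms of `b n`, so `b n` and `b (n + 1)` never
need to be comparable. The price is one level of depth. -/
theorem shift {M : ℝ} (hb : ∀ n, 0 ≤ b n) (hM : ∀ n, b n ≤ M) (h : DiffBound b s (d + 1) f) :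
    DiffBound b s d (fun n x => f (n + 1) x) := by
  simpa using h.pred.add (h.2.lower hb hM)

/-- Discrete Leibniz rule `Δ(fg) = Δf · g(· + 1) + f · Δg`, by induction on the depth. -/
theorem mul {M : ℝ} (hb : ∀ n, 0 ≤ b n) (hM : ∀ n, b n ≤ M)
    (hf : DiffBound b s d f) (hg : DiffBound b t d g) :
    DiffBound b (s + t) d (fun n x => f n x * g n x) := by
  have key : ∀ {s t : ℕ} {f g : ℕ → X → ℂ}, (∃ C : ℝ, ∀ n x, ‖f n x‖ ≤ C * b n ^ s) →
      (∃ C : ℝ, ∀ n x, ‖g n x‖ ≤ C * b n ^ t) →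
      ∃ C : ℝ, ∀ n x, ‖f n x * g n x‖ ≤ C * b n ^ (s + t) := by
    rintro s t f g ⟨C, hC⟩ ⟨C', hC'⟩
    refine ⟨C * C', fun n x => ?_⟩
    rw [norm_mul, pow_add, mul_mul_mul_comm]
    exact mul_le_mul (hC n x) (hC' n x) (norm_nonneg _) ((norm_nonneg _).trans (hC n x))
  induction d generalizing s t f g with
  | zero => exact key hf hg
  | succ d ih =>
    refine ⟨key hf.1 hg.1, ?_⟩
    have h1 := ih hf.2 (hg.shift hb hM)
    have h2 := ih hf.pred hg.2
    rw [show s + 1 + t = s + t + 1 by ring] at h1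
    rw [show s + (t + 1) = s + t + 1 by ring] at h2
    convert h1.add h2 using 3
    ring

theorem const_zero (c : ℂ) : DiffBound b 0 d (fun _ (_ : X) => c) := by
  have hz : ∀ s d, DiffBound b s d (fun _ (_ : X) => (0 : ℂ)) := by
    intro s d
    induction d generalizing s with
    | zero => exact ⟨0, by simp⟩
    | succ d ih => exact ⟨⟨0, by simp⟩, by simpa using ih (s + 1)⟩
  cases d with
  | zero => exact ⟨‖c‖, by simp⟩
  | succ d => exact ⟨⟨‖c‖, by simp⟩, by simpa using hz 1 d⟩

theorem zero : DiffBound b s d (fun _ (_ : X) => (0 : ℂ)) := by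
  induction d generalizing s with
  | zero => exact ⟨0, by simp⟩
  | succ d ih => exact ⟨⟨0, by simp⟩, by simpa using ih⟩

/-- `Δ(1/f) = -Δf / (f · f(· + 1))`, where the reciprocals on the right are needed only to depth one
less. -/
theorem inv {M δ : ℝ} (hb : ∀ n, 0 ≤ b n) (hM : ∀ n, b n ≤ M) (hδ : 0 < δ)
    (hf : DiffBound b 0 d f) (hfδ : ∀ n x, δ ≤ ‖f n x‖) :
    DiffBound b 0 d (fun n x => (f n x)⁻¹) := by
  have key : ∀ {f : ℕ → X → ℂ}, (∀ n x, δ ≤ ‖f n x‖) →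
      ∃ C : ℝ, ∀ n x, ‖(f n x)⁻¹‖ ≤ C * b n ^ 0 := by
    intro f hf
    refine ⟨δ⁻¹, fun n x => ?_⟩
    rw [norm_inv, pow_zero, mul_one]
    exact inv_anti₀ hδ (hf n x)
  induction d generalizing f with
  | zero => exact key hfδ
  | succ d ih =>
    refine ⟨key hfδ, ?_⟩
    have h1 := ih hf.pred hfδ
    have h2 := ih (hf.shift hb hM) fun n x => hfδ (n + 1) x
    have h3 := ((hf.2.mul hb hM h1).mul hb hM h2).neg
    simp only [add_zero] at h3
    convert h3 using 3 with n x
    have e1 : f n x ≠ 0 := norm_pos_iff.1 (hδ.trans_le (hfδ n x))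
    have e2 : f (n + 1) x ≠ 0 := norm_pos_iff.1 (hδ.trans_le (hfδ (n + 1) x))
    field_simp
    ring

/-- `Δ√f = Δf / (√f + √f(· + 1))`, with a denominator bounded away from zero. -/
theorem sqrt {M δ : ℝ} {f : ℕ → X → ℝ} (hb : ∀ n, 0 ≤ b n) (hM : ∀ n, b n ≤ M) (hδ : 0 < δ)
    (hf : DiffBound b 0 d (fun n x => (f n x : ℂ))) (hfδ : ∀ n x, δ ≤ f n x) :
    DiffBound b 0 d (fun n x => (√(f n x) : ℂ)) := by
  have key : ∀ {f : ℕ → X → ℝ}, (∀ n x, δ ≤ f n x) →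
      (∃ C : ℝ, ∀ n x, ‖(f n x : ℂ)‖ ≤ C * b n ^ 0) →
      ∃ C : ℝ, ∀ n x, ‖(√(f n x) : ℂ)‖ ≤ C * b n ^ 0 := by
    rintro f hf ⟨C, hC⟩
    refine ⟨√C, fun n x => ?_⟩
    have := hC n x
    rw [Complex.norm_of_nonneg (hδ.le.trans (hf n x)), pow_zero, mul_one] at this
    rw [Complex.norm_of_nonneg (Real.sqrt_nonneg _), pow_zero, mul_one]
    exact Real.sqrt_le_sqrt this
  induction d generalizing f with
  | zero => exact key hfδ hf
  | succ d ih =>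
    refine ⟨key hfδ hf.1, ?_⟩
    have h1 := ih hf.pred hfδ
    have h2 := ih (f := fun n x => f (n + 1) x) (hf.shift hb hM) fun n x => hfδ (n + 1) x
    have h3 : DiffBound b 0 d (fun n x => ((√(f n x) : ℂ) + (√(f (n + 1) x) : ℂ))⁻¹) := by
      refine inv hb hM (Real.sqrt_pos.2 hδ) (h1.add h2) fun n x => ?_
      rw [← Complex.ofReal_add, Complex.norm_of_nonneg (by positivity)]
      exact (Real.sqrt_le_sqrt (hfδ n x)).trans (le_add_of_nonneg_right (Real.sqrt_nonneg _))
    have h4 := hf.2.mul hb hM h3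
    simp only [add_zero] at h4
    convert h4 using 3 with n x
    have e1 : 0 < √(f n x) := Real.sqrt_pos.2 (hδ.trans_le (hfδ n x))
    have e2 : 0 < √(f (n + 1) x) := Real.sqrt_pos.2 (hδ.trans_le (hfδ (n + 1) x))
    rw [← Complex.ofReal_add, ← Complex.ofReal_sub, ← Complex.ofReal_inv, ← Complex.ofReal_sub,
      ← Complex.ofReal_mul, Complex.ofReal_inj, eq_mul_inv_iff_mul_eq₀ (by positivity)]
    nlinarith [Real.mul_self_sqrt (hδ.le.trans (hfδ n x)),
      Real.mul_self_sqrt (hδ.le.trans (hfδ (n + 1) x))]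

/-! ### Almost invariant sequences of the Möbius maps. -/

/-- Newton iteration: an approximate fixed point of the Möbius transformations
`t ↦ (u + t v) / (p + t q)` may be improved until the residual is `O(b ^ r)`. -/
theorem exists_approx_fixed {M : ℝ} {r : ℕ} {p q u v t₀ D : ℕ → X → ℂ}
    (hb : ∀ n, 0 ≤ b n) (hM : ∀ n, b n ≤ M)
    (hp : DiffBound b 0 r p) (hq : DiffBound b 0 r q)
    (ht : DiffBound b 0 r t₀) (hD : DiffBound b 0 r D)
    (hroot : ∀ n x, u n x + t₀ n x * (v n x - p n x) - t₀ n x ^ 2 * q n x = 0)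
    (hder : ∀ n x, (v n x - p n x - 2 * t₀ n x * q n x) * D n x = 1) (m : ℕ) (hm : m < r) :
    ∃ t : ℕ → X → ℂ, DiffBound b 1 (r - 1 - m) (fun n x => t n x - t₀ n x) ∧
      DiffBound b (m + 1) (r - 1 - m) (fun n x =>
        u n x + t n x * v n x - t (n + 1) x * p n x - t n x * t (n + 1) x * q n x) := by
  induction m with
  | zero =>
    -- By the fixed point equation the residual of `t₀` is `-Δt₀ · (p + t₀ q)`, hence `O(b)`.
    refine ⟨t₀, by simpa using zero, ?_⟩
    obtain ⟨r, rfl⟩ : ∃ k, r = k + 1 := ⟨r - 1, by omega⟩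
    have h := (ht.2.mul hb hM (hp.pred.add (ht.pred.mul hb hM hq.pred))).neg
    simp only [add_zero, zero_add] at h
    change DiffBound b 1 r _
    convert h using 3 with n x
    linear_combination hroot n x
  | succ m ih =>
    obtain ⟨t, h1, h2⟩ := ih (by omega)
    obtain ⟨d, hd⟩ : ∃ d, r - 1 - m = d + 1 := ⟨r - 1 - m - 1, by omega⟩
    rw [hd] at h1 h2
    rw [show r - 1 - (m + 1) = d by omega]
    set R : ℕ → X → ℂ := fun n x =>
      u n x + t n x * v n x - t (n + 1) x * p n x - t n x * t (n + 1) x * q n x with hR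
    have h3 := (h2.mul hb hM (hD.mono_depth (e := d + 1) (by omega))).neg
    rw [add_zero] at h3
    -- Newton correction: `D` inverts the derivative `v - p - 2 t₀ q` of the fixed point equation at
    -- `t₀`.
    set δ : ℕ → X → ℂ := fun n x => -(R n x * D n x) with hδ
    have hp' := hp.mono_depth (e := d) (by omega)
    have hq' := hq.mono_depth (e := d) (by omega)
    have ht' := ht.mono_depth (e := d + 1) (by omega)
    refine ⟨fun n x => t n x + δ n x, ?_, ?_⟩
    · convert h1.pred.add (h3.pred.mono_weight hb hM (s := 1) (by omega)) using 3
      ring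
    -- After cancellation of `R` four errors remain: `p Δδ`, and `q` times each of `t Δδ`, `((t -
    -- t₀) + (t(· + 1) - t₀)) δ` and `δ δ(· + 1)`. All are `O(b ^ (m + 2))`.
    have a1 := hp'.mul hb hM h3.2
    have a2 := ((h1.pred.lower hb hM).add ht'.pred).mul hb hM h3.2
    have a3 := (h1.pred.add ((h1.shift hb hM).add ht'.2)).mul hb hM h3.pred
    have a4 := (h3.pred.mul hb hM (h3.shift hb hM)).mono_weight hb hM (s := m + 1 + 1) (by omega)
    rw [zero_add] at a1 a2
    rw [show 0 + 1 + (m + 1) = m + 1 + 1 by ring] at a3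
    have a5 := (hq'.mul hb hM ((a2.add a3).add a4))
    rw [zero_add] at a5
    convert (a1.add a5).neg using 3 with n x
    have hRδ : R n x = -((v n x - p n x - 2 * t₀ n x * q n x) * δ n x) := by
      simp only [hδ]
      linear_combination (-R n x) * hder n x
    have hRe : R n x =
      u n x + t n x * v n x - t (n + 1) x * p n x - t n x * t (n + 1) x * q n x := rfl
    linear_combination hRδ - hRe

end DiffBound

/-! ### The approximately conserved quantity. -/

/-- Discrete Grönwall: `∏ (1 + ε k) ≤ exp (∑ ε k)` bounds `h` uniformly, after which the increments
are dominated by a summable sequence independent of `y`. -/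
theorem exists_uniform_limit_of_relative_increments {Y : Type*} {h : ℕ → Y → ℝ} {ε : ℕ → ℝ} {H : ℝ}
    (hε : Summable ε) (hε0 : ∀ n, 0 ≤ ε n) (h0 : ∀ y, |h 0 y| ≤ H)
    (hstep : ∀ n y, |h (n + 1) y - h n y| ≤ ε n * |h n y|) :
    ∃ (g : Y → ℝ) (κ : ℕ → ℝ) (H' : ℝ), Tendsto κ atTop (𝓝 0) ∧ (∀ n y, |h n y| ≤ H') ∧
      ∀ n y, |h n y - g y| ≤ κ n := by
  have hexp : ∀ n y, |h n y| ≤ |H| * Real.exp (∑ k ∈ Finset.range n, ε k) := by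
    intro n y
    induction n with
    | zero => simpa using (h0 y).trans (le_abs_self H)
    | succ n ih =>
      calc |h (n + 1) y| = |(h (n + 1) y - h n y) + h n y| := by ring_nf
        _ ≤ |h (n + 1) y - h n y| + |h n y| := abs_add_le _ _
        _ ≤ ε n * |h n y| + |h n y| := by gcongr; exact hstep n y
        _ = |h n y| * (ε n + 1) := by ring
        _ ≤ (|H| * Real.exp (∑ k ∈ Finset.range n, ε k)) * Real.exp (ε n) := by
          have := hε0 n
          gcongr
          exact Real.add_one_le_exp _
        _ = _ := by rw [Finset.sum_range_succ, Real.exp_add]; ring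
  set H' := |H| * Real.exp (∑' k, ε k) with hH'
  have hbd : ∀ n y, |h n y| ≤ H' := by
    intro n y
    refine (hexp n y).trans ?_
    rw [hH']
    gcongr
    exact hε.sum_le_tsum _ fun k _ => hε0 k
  have hsum : Summable fun n => ε n * H' := hε.mul_right H'
  have hdist : ∀ y n, dist (h n y) (h n.succ y) ≤ ε n * H' := by
    intro y n
    rw [dist_comm, Real.dist_eq]
    exact (hstep n y).trans (mul_le_mul_of_nonneg_left (hbd n y) (hε0 n))
  have hlim : ∀ y, ∃ l, Tendsto (fun n => h n y) atTop (𝓝 l) := fun y =>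
    cauchySeq_tendsto_of_complete (cauchySeq_of_dist_le_of_summable _ (hdist y) hsum)
  choose g hg using hlim
  refine ⟨g, fun n => ∑' k, ε (k + n) * H', H', tendsto_sum_nat_add fun n => ε n * H', hbd,
    fun n y => ?_⟩
  have := dist_le_tsum_of_dist_le_of_tendsto _ (hdist y) hsum (hg y) n
  rw [Real.dist_eq] at this
  simpa only [add_comm n] using this

/-- Put `γ = v - t' q`, `η = w₂ - t w₁`, and let `R` be the residual. The new functional is `γ η + R
w₁`, and `Im t |γ|² = (p v - q u) Im t' + Im (conj γ · R)`. For `R = 0` only the conservation law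
remains. -/
theorem normSq_functional_step (p q u v w₁ w₂ : ℝ) (t t' : ℂ) :
    t.im * Complex.normSq ((u * w₁ + v * w₂) - t' * (p * w₁ + q * w₂)) =
      (p * v - q * u) * t'.im * Complex.normSq (w₂ - t * w₁) +
      Complex.normSq (w₂ - t * w₁) *
        ((starRingEnd ℂ) (v - t' * q) * (u + t * v - t' * p - t * t' * q)).im +
      t.im * (2 * ((v - t' * q) * (w₂ - t * w₁) *
        (starRingEnd ℂ) (u + t * v - t' * p - t * t' * q)).re * w₁ +
        Complex.normSq (u + t * v - t' * p - t * t' * q) * w₁ ^ 2) := by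
  simp only [Complex.normSq_apply, Complex.add_re, Complex.add_im, Complex.sub_re, Complex.sub_im,
    Complex.mul_re, Complex.mul_im, Complex.ofReal_re, Complex.ofReal_im, map_sub, map_add, map_mul,
    Complex.conj_re, Complex.conj_im]
  ring

/-- For real `w₁, w₂` the imaginary part of `w₂ - t w₁` is `-w₁ Im t`. -/
theorem abs_le_norm_sub_div {w₁ w₂ δ : ℝ} {t : ℂ} (hδ : 0 < δ) (ht : δ ≤ |t.im|) :
    |w₁| ≤ ‖(w₂ : ℂ) - t * w₁‖ / δ := by
  rw [le_div_iff₀ hδ]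
  calc |w₁| * δ ≤ |w₁| * |t.im| := by gcongr
    _ = |((w₂ : ℂ) - t * w₁).im| := by simp [abs_mul, mul_comm]
    _ ≤ _ := Complex.abs_im_le_norm _

/-- The relative variation of the approximately conserved quantity `a |w₂ - t w₁|² / Im t`
under one step of the recurrence. -/
theorem conserved_step {p q u v w₁ w₂ a a' δ G T P κ : ℝ} {t t' : ℂ} (ha : 0 < a) (ha' : 0 < a')
    (hdet : a' * (p * v - q * u) = a) (hδ : 0 < δ) (ht : δ ≤ |t.im|) (ht' : δ ≤ |t'.im|)
    (hG : ‖(v : ℂ) - t' * q‖ ≤ G) (hT : ‖t‖ ≤ T) (hκ : a' / a ≤ κ)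
    (hP : ‖(u : ℂ) + t * v - t' * p - t * t' * q‖ ≤ P) :
    |a' * Complex.normSq ((u * w₁ + v * w₂) - t' * (p * w₁ + q * w₂)) / t'.im -
      a * Complex.normSq (w₂ - t * w₁) / t.im| ≤
    (κ * T * (3 * G / δ ^ 2 + P / δ ^ 3)) *
      ‖(u : ℂ) + t * v - t' * p - t * t' * q‖ * |a * Complex.normSq (w₂ - t * w₁) / t.im| := by
  have key := normSq_functional_step p q u v w₁ w₂ t t'
  have hw := abs_le_norm_sub_div (w₁ := w₁) (w₂ := w₂) hδ ht
  set R : ℂ := (u : ℂ) + t * v - t' * p - t * t' * q with hR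
  set γ : ℂ := (v : ℂ) - t' * q with hγ
  set η : ℂ := (w₂ : ℂ) - t * w₁ with hη
  set N' := Complex.normSq ((u * w₁ + v * w₂) - t' * (p * w₁ + q * w₂))
  have hti : t.im ≠ 0 := abs_pos.1 (hδ.trans_le ht)
  have hti' : t'.im ≠ 0 := abs_pos.1 (hδ.trans_le ht')
  -- The main terms cancel through `a = a' (p v - q u)`; every surviving term carries a factor `R`.
  have e1 : a' * N' / t'.im - a * Complex.normSq η / t.im =
      a' * (Complex.normSq η * ((starRingEnd ℂ) γ * R).im / (t.im * t'.im) +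
        (2 * (γ * η * (starRingEnd ℂ) R).re * w₁ + Complex.normSq R * w₁ ^ 2) / t'.im) := by
    rw [← hdet]
    field_simp
    linear_combination key
  have hG0 : 0 ≤ G := (norm_nonneg _).trans hG
  have hT0 : 0 ≤ T := (norm_nonneg _).trans hT
  have hP0 : 0 ≤ P := (norm_nonneg _).trans hP
  have hκ0 : 0 ≤ κ := (by positivity : (0 : ℝ) ≤ a' / a).trans hκ
  have b1 : |((starRingEnd ℂ) γ * R).im| ≤ G * ‖R‖ := by
    refine (Complex.abs_im_le_norm _).trans ?_
    rw [norm_mul, RCLike.norm_conj]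
    gcongr
  have b2 : |(γ * η * (starRingEnd ℂ) R).re| ≤ G * ‖η‖ * ‖R‖ := by
    refine (Complex.abs_re_le_norm _).trans ?_
    rw [norm_mul, norm_mul, RCLike.norm_conj]
    gcongr
  have c1 : |Complex.normSq η * ((starRingEnd ℂ) γ * R).im / (t.im * t'.im)| ≤
      ‖η‖ ^ 2 * (G * ‖R‖) / (δ * δ) := by
    rw [abs_div, abs_mul, abs_mul, Complex.normSq_eq_norm_sq, abs_of_nonneg (sq_nonneg ‖η‖)]
    gcongr
  -- One factor of `|R|²` is absorbed into `P`, which leaves a bound linear in `‖R‖`.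
  have c2 : |(2 * (γ * η * (starRingEnd ℂ) R).re * w₁ + Complex.normSq R * w₁ ^ 2) / t'.im| ≤
      (2 * (G * ‖η‖ * ‖R‖) * (‖η‖ / δ) + (P * ‖R‖) * (‖η‖ / δ) ^ 2) / δ := by
    rw [abs_div]
    gcongr
    refine (abs_add_le _ _).trans ?_
    rw [abs_mul, abs_mul, abs_mul, abs_pow, abs_two, Complex.normSq_eq_norm_sq,
      abs_of_nonneg (sq_nonneg ‖R‖), sq ‖R‖]
    gcongr
  have hη2 : a * ‖η‖ ^ 2 ≤ T * |a * Complex.normSq η / t.im| := by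
    rw [abs_div, abs_mul, Complex.normSq_eq_norm_sq, abs_of_nonneg (sq_nonneg ‖η‖), abs_of_pos ha,
      mul_div_assoc', le_div_iff₀ (abs_pos.2 hti), mul_comm T]
    gcongr
    exact (Complex.abs_im_le_norm t).trans hT
  rw [e1, abs_mul, abs_of_pos ha']
  calc a' * |_| ≤ a' * (‖η‖ ^ 2 * (G * ‖R‖) / (δ * δ) +
        (2 * (G * ‖η‖ * ‖R‖) * (‖η‖ / δ) + (P * ‖R‖) * (‖η‖ / δ) ^ 2) / δ) := by
        gcongr
        exact (abs_add_le _ _).trans (add_le_add c1 c2)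
    _ = (a' / a) * ((3 * G / δ ^ 2 + P / δ ^ 3) * ‖R‖) * (a * ‖η‖ ^ 2) := by
        field_simp
        ring
    _ ≤ κ * ((3 * G / δ ^ 2 + P / δ ^ 3) * ‖R‖) * (T * |a * Complex.normSq η / t.im|) := by
        gcongr
    _ = _ := by ring

theorem exists_uniform_limit_conserved {Y : Type*} {r : ℕ} {b A : ℕ → ℝ}
    {p q u v w₁ w₂ : ℕ → Y → ℝ} {t : ℕ → Y → ℂ} {C δ κ H : ℝ}
    (hA : ∀ n, 0 < A n) (hκ : ∀ n, A (n + 1) / A n ≤ κ)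
    (hb : ∀ n, 0 ≤ b n) (hbr : Summable fun n => b n ^ r)
    (hdet : ∀ n y, A (n + 1) * (p n y * v n y - q n y * u n y) = A n)
    (hw₁ : ∀ n y, w₁ (n + 1) y = p n y * w₁ n y + q n y * w₂ n y)
    (hw₂ : ∀ n y, w₂ (n + 1) y = u n y * w₁ n y + v n y * w₂ n y)
    (hq : ∀ n y, |q n y| ≤ C) (hv : ∀ n y, |v n y| ≤ C) (ht : ∀ n y, ‖t n y‖ ≤ C)
    (hR : ∀ n y, ‖(u n y : ℂ) + t n y * v n y - t (n + 1) y * p n y -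
      t n y * t (n + 1) y * q n y‖ ≤ C * b n ^ r)
    (hδ : 0 < δ) (htδ : ∀ n y, δ ≤ |(t n y).im|)
    (hH₁ : ∀ y, |w₁ 0 y| ≤ H) (hH₂ : ∀ y, |w₂ 0 y| ≤ H) :
    ∃ (g : Y → ℝ) (ε : ℕ → ℝ) (H' : ℝ), Tendsto ε atTop (𝓝 0) ∧
      (∀ n y, |A n * Complex.normSq (w₂ n y - t n y * w₁ n y) / (t n y).im| ≤ H') ∧
      ∀ n y, |A n * Complex.normSq (w₂ n y - t n y * w₁ n y) / (t n y).im - g y| ≤ ε n := by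
  rcases isEmpty_or_nonempty Y with hY | ⟨⟨y₀⟩⟩
  · exact ⟨fun _ => 0, fun _ => 0, 0, tendsto_const_nhds, fun _ y => (hY.false y).elim,
      fun _ y => (hY.false y).elim⟩
  have hC0 : 0 ≤ C := (abs_nonneg _).trans (hq 0 y₀)
  have hκ0 : 0 ≤ κ := (div_pos (hA 1) (hA 0)).le.trans (hκ 0)
  obtain ⟨M, hM⟩ : ∃ M, ∀ n, b n ^ r ≤ M := by
    obtain ⟨M, hM⟩ := hbr.tendsto_atTop_zero.bddAbove_range
    exact ⟨M, fun n => hM ⟨n, rfl⟩⟩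
  have hM0 : 0 ≤ M := (pow_nonneg (hb 0) r).trans (hM 0)
  set c := κ * C * (3 * (C + C * C) / δ ^ 2 + C * M / δ ^ 3) with hc
  have hc0 : 0 ≤ c := by positivity
  refine exists_uniform_limit_of_relative_increments
    (ε := fun n => c * (C * b n ^ r)) (H := A 0 * (H + C * H) ^ 2 / δ) ((hbr.mul_left C).mul_left c)
    (fun n => by have := hb n; positivity) (fun y => ?_) (fun n y => ?_)
  · have hH0 : 0 ≤ H := (abs_nonneg _).trans (hH₁ y)
    rw [abs_div, abs_mul, abs_of_pos (hA 0), Complex.normSq_eq_norm_sq, abs_of_nonneg (sq_nonneg _)]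
    have := (hA 0).le
    gcongr
    · refine (norm_sub_le _ _).trans ?_
      rw [norm_mul, Complex.norm_real, Complex.norm_real]
      exact add_le_add (hH₂ y) (mul_le_mul (ht 0 y) (hH₁ y) (abs_nonneg _) hC0)
    · exact htδ 0 y
  · have hγ : ‖(v n y : ℂ) - t (n + 1) y * q n y‖ ≤ C + C * C := by
      refine (norm_sub_le _ _).trans ?_
      rw [norm_mul, Complex.norm_real, Complex.norm_real]
      exact add_le_add (hv n y) (mul_le_mul (ht _ y) (hq n y) (abs_nonneg _) hC0)
    have h := conserved_step (w₁ := w₁ n y) (w₂ := w₂ n y) (hA n) (hA (n + 1)) (hdet n y) hδ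
      (htδ n y) (htδ (n + 1) y) hγ (ht n y) (hκ n)
      ((hR n y).trans (mul_le_mul_of_nonneg_left (hM n) hC0))
    rw [hw₁, hw₂]
    push_cast
    refine h.trans ?_
    gcongr
    exact hR n y

/-! ### Comparison of the Turán form with the conserved quantity. -/

theorem turan_form_sub_conserved {p q u v w₁ w₂ a a' δ C s β κ H : ℝ} {t t₀ : ℂ} (ha : 0 < a)
    (hδ : 0 < δ) (ht : δ ≤ |t.im|) (htC : ‖t‖ ≤ C) (hq : |q| ≤ C) (hκ : |a' / a| ≤ κ)
    (hre : 2 * q * t₀.re = v - p) (him : 2 * q * t₀.im = s) (hsq : q * Complex.normSq t₀ = -u)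
    (hβ : ‖t - t₀‖ ≤ β) (hH : |a * Complex.normSq (w₂ - t * w₁) / t.im| ≤ H) :
    |a' * (q * w₂ ^ 2 + (p - v) * w₁ * w₂ - u * w₁ ^ 2) -
      s / 2 * (a * Complex.normSq (w₂ - t * w₁) / t.im)| ≤
      C * (C * H) * (|a' / a - 1| + κ * (β / δ * (2 + β / δ)) + β / δ) := by
  have hw := abs_le_norm_sub_div (w₁ := w₁) (w₂ := w₂) hδ ht
  have hform : q * w₂ ^ 2 + (p - v) * w₁ * w₂ - u * w₁ ^ 2 =
      q * Complex.normSq (w₂ - t₀ * w₁) := by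
    simp only [Complex.normSq_apply, Complex.sub_re, Complex.sub_im, Complex.mul_re,
      Complex.mul_im, Complex.ofReal_re, Complex.ofReal_im] at hsq ⊢
    linear_combination w₁ * w₂ * hre - w₁ ^ 2 * hsq
  have hti : t.im ≠ 0 := abs_pos.1 (hδ.trans_le ht)
  have hβ0 : 0 ≤ β := (norm_nonneg _).trans hβ
  have hC0 : 0 ≤ C := (norm_nonneg _).trans htC
  have hH0 : 0 ≤ H := (abs_nonneg _).trans hH
  have hκ0 : 0 ≤ κ := (abs_nonneg _).trans hκ
  set η : ℂ := (w₂ : ℂ) - t * w₁ with hη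
  set η₀ : ℂ := (w₂ : ℂ) - t₀ * w₁ with hη₀
  have hN : a * ‖η‖ ^ 2 ≤ C * H := by
    have : |a * Complex.normSq η / t.im| * |t.im| = a * ‖η‖ ^ 2 := by
      rw [← abs_mul, div_mul_cancel₀ _ hti, Complex.normSq_eq_norm_sq, abs_of_nonneg]
      positivity
    rw [← this, mul_comm C]
    gcongr
    exact (Complex.abs_im_le_norm t).trans htC
  have hdiff : ‖η₀ - η‖ ≤ β / δ * ‖η‖ := by
    have : η₀ - η = (t - t₀) * w₁ := by rw [hη, hη₀]; ring
    rw [this, norm_mul, Complex.norm_real, Real.norm_eq_abs, div_mul_eq_mul_div, ← mul_div_assoc']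
    gcongr
  have hN0 : |‖η₀‖ ^ 2 - ‖η‖ ^ 2| ≤ β / δ * (2 + β / δ) * ‖η‖ ^ 2 := by
    have h1 : |‖η₀‖ - ‖η‖| ≤ β / δ * ‖η‖ := (abs_norm_sub_norm_le _ _).trans hdiff
    have h2 : ‖η₀‖ + ‖η‖ ≤ (2 + β / δ) * ‖η‖ := by linarith [(abs_le.1 h1).2]
    rw [sq_sub_sq, abs_mul, abs_of_nonneg (by positivity), mul_comm]
    calc _ ≤ (β / δ * ‖η‖) * ((2 + β / δ) * ‖η‖) := by gcongr
      _ = _ := by ring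
  have him' : |(t.im - t₀.im) / t.im| ≤ β / δ := by
    rw [abs_div]
    gcongr
    rw [← Complex.sub_im]
    exact (Complex.abs_im_le_norm _).trans hβ
  -- Three sources of error: `a'` in place of `a`, `t₀` in place of `t` in the functional, and `Im
  -- t₀` in place of `Im t`.
  have e : a' * (q * w₂ ^ 2 + (p - v) * w₁ * w₂ - u * w₁ ^ 2) -
      s / 2 * (a * Complex.normSq η / t.im) =
      q * ((a' / a - 1) * (a * ‖η‖ ^ 2) + a' / a * (a * (‖η₀‖ ^ 2 - ‖η‖ ^ 2)) +
        (a * ‖η‖ ^ 2) * ((t.im - t₀.im) / t.im)) := by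
    rw [hform, ← him, Complex.normSq_eq_norm_sq, Complex.normSq_eq_norm_sq]
    field_simp
    ring
  rw [e, abs_mul]
  calc |q| * |_| ≤ C * (|a' / a - 1| * (C * H) +
        κ * (β / δ * (2 + β / δ) * (C * H)) + (C * H) * (β / δ)) := by
        gcongr
        refine (abs_add_le _ _).trans (add_le_add ((abs_add_le _ _).trans (add_le_add ?_ ?_)) ?_)
        · rw [abs_mul, abs_of_nonneg (by positivity : 0 ≤ a * ‖η‖ ^ 2)]
          gcongr
        · rw [abs_mul, abs_mul, abs_of_pos ha]
          refine mul_le_mul hκ ?_ (by positivity) hκ0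
          calc a * |‖η₀‖ ^ 2 - ‖η‖ ^ 2| ≤ a * (β / δ * (2 + β / δ) * ‖η‖ ^ 2) := by gcongr
            _ = β / δ * (2 + β / δ) * (a * ‖η‖ ^ 2) := by ring
            _ ≤ _ := by gcongr
        · rw [abs_mul, abs_of_nonneg (by positivity : 0 ≤ a * ‖η‖ ^ 2)]
          gcongr
    _ = _ := by ring

theorem exists_uniform_limit_turan_form {Y : Type*} {r : ℕ} (hr : 1 ≤ r) {b A : ℕ → ℝ}
    {p q u v w₁ w₂ s : ℕ → Y → ℝ} {t t₀ : ℕ → Y → ℂ} {σ : Y → ℝ} {κ : ℕ → ℝ} {C δ : ℝ}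
    (hA : ∀ n, 0 < A n) (hA1 : Tendsto (fun n => A (n + 1) / A n) atTop (𝓝 1))
    (hb : ∀ n, 0 ≤ b n) (hbr : Summable fun n => b n ^ r)
    (hdet : ∀ n y, A (n + 1) * (p n y * v n y - q n y * u n y) = A n)
    (hw₁ : ∀ n y, w₁ (n + 1) y = p n y * w₁ n y + q n y * w₂ n y)
    (hw₂ : ∀ n y, w₂ (n + 1) y = u n y * w₁ n y + v n y * w₂ n y)
    (hq : ∀ n y, |q n y| ≤ C) (hv : ∀ n y, |v n y| ≤ C) (hs : ∀ n y, |s n y| ≤ C)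
    (ht : ∀ n y, ‖t n y‖ ≤ C)
    (hR : ∀ n y, ‖(u n y : ℂ) + t n y * v n y - t (n + 1) y * p n y -
      t n y * t (n + 1) y * q n y‖ ≤ C * b n ^ r)
    (htt₀ : ∀ n y, ‖t n y - t₀ n y‖ ≤ C * b n)
    (hδ : 0 < δ) (ht₀δ : ∀ n y, δ ≤ |(t₀ n y).im|)
    (hre : ∀ n y, 2 * q n y * (t₀ n y).re = v n y - p n y)
    (him : ∀ n y, 2 * q n y * (t₀ n y).im = s n y)
    (hsq : ∀ n y, q n y * Complex.normSq (t₀ n y) = -u n y)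
    (hκ : Tendsto κ atTop (𝓝 0)) (hσ : ∀ n y, |s n y - σ y| ≤ κ n)
    (hH : ∀ n, ∃ H, ∀ y, |w₁ n y| ≤ H ∧ |w₂ n y| ≤ H) :
    ∃ (g : Y → ℝ) (ε : ℕ → ℝ) (m : ℕ), Tendsto ε atTop (𝓝 0) ∧ ∀ n y,
      |A (n + m + 1) * (q (n + m) y * w₂ (n + m) y ^ 2 +
        (p (n + m) y - v (n + m) y) * w₁ (n + m) y * w₂ (n + m) y -
        u (n + m) y * w₁ (n + m) y ^ 2) - g y| ≤ ε n := by
  have hb0 : Tendsto b atTop (𝓝 0) := by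
    have h := (hbr.tendsto_atTop_zero).rpow_const (p := (r : ℝ)⁻¹) (Or.inr (by positivity))
    rw [Real.zero_rpow (by positivity)] at h
    exact h.congr fun n => Real.pow_rpow_inv_natCast (hb n) (by omega)
  have hCb : Tendsto (fun n => C * b n) atTop (𝓝 0) := by simpa using hb0.const_mul C
  -- From index `m` on, `t` is within `δ / 2` of `t₀`, so its imaginary part stays away from zero.
  obtain ⟨m, hm⟩ := eventually_atTop.1 (hCb.eventually_le_const (half_pos hδ))
  have htδ : ∀ n y, δ / 2 ≤ |(t (n + m) y).im| := by
    intro n y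
    have h1 : |(t (n + m) y).im - (t₀ (n + m) y).im| ≤ δ / 2 := by
      rw [← Complex.sub_im]
      exact (Complex.abs_im_le_norm _).trans ((htt₀ _ y).trans (hm _ (by omega)))
    have h2 := ht₀δ (n + m) y
    have h3 := abs_sub_abs_le_abs_sub (t₀ (n + m) y).im (t (n + m) y).im
    rw [abs_sub_comm] at h3
    linarith
  have hAb : ∃ κ, ∀ n, A (n + 1) / A n ≤ κ := by
    obtain ⟨κ, h⟩ := hA1.bddAbove_range
    exact ⟨κ, fun n => h ⟨n, rfl⟩⟩
  obtain ⟨k, hk⟩ := hAb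
  obtain ⟨H, hH⟩ := hH m
  obtain ⟨g, ε, H', hε, hbd, hlim⟩ := exists_uniform_limit_conserved (Y := Y) (r := r)
    (b := fun n => b (n + m)) (A := fun n => A (n + m)) (p := fun n => p (n + m))
    (q := fun n => q (n + m)) (u := fun n => u (n + m)) (v := fun n => v (n + m))
    (w₁ := fun n => w₁ (n + m)) (w₂ := fun n => w₂ (n + m)) (t := fun n => t (n + m))
    (C := C) (δ := δ / 2) (κ := k) (H := H)
    (fun n => hA _) (fun n => by simpa only [add_right_comm] using hk (n + m)) (fun n => hb _)
    ((summable_nat_add_iff m).2 hbr)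
    (fun n y => by simpa only [add_right_comm] using hdet (n + m) y)
    (fun n y => by simpa only [add_right_comm] using hw₁ (n + m) y)
    (fun n y => by simpa only [add_right_comm] using hw₂ (n + m) y)
    (fun n y => hq _ y) (fun n y => hv _ y) (fun n y => ht _ y)
    (fun n y => by simpa only [add_right_comm] using hR (n + m) y)
    (half_pos hδ) htδ (fun y => by simpa using (hH y).1) (fun y => by simpa using (hH y).2)
  have hg : ∀ y, |g y| ≤ H' + ε 0 := by
    intro y
    have h1 := hbd 0 y
    have h2 := hlim 0 y
    rw [abs_sub_comm] at h2
    linarith [abs_sub_abs_le_abs_sub (g y)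
      (A (0 + m) * Complex.normSq (w₂ (0 + m) y - t (0 + m) y * w₁ (0 + m) y) / (t (0 + m) y).im)]
  refine ⟨fun y => σ y / 2 * g y, fun n => C * (C * H') * (|A (n + m + 1) / A (n + m) - 1| +
    k * (C * b (n + m) / (δ / 2) * (2 + C * b (n + m) / (δ / 2))) + C * b (n + m) / (δ / 2)) +
    C / 2 * ε n + κ (n + m) / 2 * (H' + ε 0), m, ?_, fun n y => ?_⟩
  · have h1 : Tendsto (fun n => |A (n + m + 1) / A (n + m) - 1|) atTop (𝓝 0) := by
      have := ((tendsto_add_atTop_iff_nat m).2 hA1).sub_const 1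
      simpa using this.abs
    have h2 : Tendsto (fun n => C * b (n + m) / (δ / 2)) atTop (𝓝 0) := by
      simpa using ((tendsto_add_atTop_iff_nat m).2 hCb).div_const (δ / 2)
    have h3 := (tendsto_add_atTop_iff_nat m).2 hκ
    have h4 := ((((h1.add ((h2.mul (h2.const_add 2)).const_mul k)).add h2).const_mul
      (C * (C * H'))).add (hε.const_mul (C / 2))).add ((h3.div_const 2).mul_const (H' + ε 0))
    simpa using h4
  · have h1 := turan_form_sub_conserved (a' := A (n + m + 1)) (κ := k)
      (p := p (n + m) y) (v := v (n + m) y) (hA (n + m)) (half_pos hδ)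
      (htδ n y) (ht _ y) (hq _ y)
      (by rw [abs_of_pos (div_pos (hA _) (hA _))]; exact hk _) (hre _ y) (him _ y) (hsq _ y)
      (htt₀ _ y) (hbd n y)
    have h2 := hlim n y
    set h := A (n + m) * Complex.normSq (w₂ (n + m) y - t (n + m) y * w₁ (n + m) y) /
      (t (n + m) y).im
    set S := A (n + m + 1) * (q (n + m) y * w₂ (n + m) y ^ 2 +
        (p (n + m) y - v (n + m) y) * w₁ (n + m) y * w₂ (n + m) y -
        u (n + m) y * w₁ (n + m) y ^ 2)
    have e : S - σ y / 2 * g y = (S - s (n + m) y / 2 * h) + s (n + m) y / 2 * (h - g y) +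
        (s (n + m) y - σ y) / 2 * g y := by ring
    rw [e]
    refine (abs_add_le _ _).trans (add_le_add ((abs_add_le _ _).trans (add_le_add h1 ?_)) ?_)
    · rw [abs_mul, abs_div, abs_two]
      have : 0 ≤ C := (abs_nonneg _).trans (hs 0 y)
      gcongr
      exact hs _ y
    · rw [abs_mul, abs_div, abs_two]
      have : 0 ≤ κ (n + m) := (abs_nonneg _).trans (hσ _ y)
      gcongr
      · exact hσ _ y
      · exact hg y

/-! ### Uniform convergence of polynomials of bounded degree. -/

/-- The limit inherits the expansion in the nodes, so the error on all of `K` is controlled by the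
errors at finitely many points. -/
theorem exists_uniform_bound_of_finite_expansion {f : ℕ → ℝ → ℝ} {L : ℝ → ℝ} {K : Set ℝ}
    {T : Finset ℝ} {e : ℝ → ℝ → ℝ} {M : ℝ} (hT : ↑T ⊆ K)
    (hM : ∀ j ∈ T, ∀ x ∈ K, |e j x| ≤ M)
    (hf : ∀ n, ∀ x ∈ K, f n x = ∑ j ∈ T, e j x * f n j)
    (hL : ∀ x ∈ K, Tendsto (fun n => f n x) atTop (𝓝 (L x))) :
    ∃ κ : ℕ → ℝ, Tendsto κ atTop (𝓝 0) ∧ ∀ n, ∀ x ∈ K, |f n x - L x| ≤ κ n := by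
  refine ⟨fun n => ∑ j ∈ T, M * |f n j - L j|, ?_, fun n x hx => ?_⟩
  · have : Tendsto (fun n => ∑ j ∈ T, M * |f n j - L j|) atTop (𝓝 (∑ j ∈ T, (0 : ℝ))) := by
      refine tendsto_finsetSum _ fun j hj => ?_
      have := ((hL j (hT hj)).sub_const (L j)).abs.const_mul M
      simpa using this
    simpa using this
  · have hLx : L x = ∑ j ∈ T, e j x * L j := by
      refine tendsto_nhds_unique (hL x hx) ?_
      simp_rw [hf _ x hx]
      exact tendsto_finsetSum _ fun j hj => (hL j (hT hj)).const_mul _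
    rw [hf n x hx, hLx, ← Finset.sum_sub_distrib]
    refine (Finset.abs_sum_le_sum_abs _ _).trans (Finset.sum_le_sum fun j hj => ?_)
    rw [← mul_sub, abs_mul]
    exact mul_le_mul_of_nonneg_right (hM j hj x hx) (abs_nonneg _)

/-- Polynomials of bounded degree which converge pointwise on a compact set converge uniformly. -/
theorem exists_uniform_bound_of_polynomial {P : ℕ → Polynomial ℝ} {D : ℕ}
    (hP : ∀ n, (P n).natDegree ≤ D) {K : Set ℝ} (hK : IsCompact K) {L : ℝ → ℝ}
    (hL : ∀ x ∈ K, Tendsto (fun n => (P n).eval x) atTop (𝓝 (L x))) :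
    ∃ κ : ℕ → ℝ, Tendsto κ atTop (𝓝 0) ∧ ∀ n, ∀ x ∈ K, |(P n).eval x - L x| ≤ κ n := by
  classical
  by_cases hfin : K.Finite
  -- A finite `K` may have too few points for interpolation; all its points serve as nodes, with
  -- indicator coefficients.
  · refine exists_uniform_bound_of_finite_expansion (T := hfin.toFinset) (M := 1)
      (e := fun j x => if x = j then 1 else 0) (by simp) ?_ ?_ hL
    · intro j _ x _
      split_ifs <;> simp
    · intro n x hx
      simp [hx]
  -- Lagrange interpolation at `D + 1` nodes in `K`; the basis polynomials are bounded on the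
  -- compact set.
  · obtain ⟨T, hTK, hT⟩ := Set.Infinite.exists_subset_card_eq hfin (D + 1)
    have hbd : ∃ M : ℝ, ∀ j ∈ T, ∀ x ∈ K, |(Lagrange.basis T id j).eval x| ≤ M := by
      have h1 : ∀ j : ℝ, ∃ M : ℝ, 0 ≤ M ∧ ∀ x ∈ K, |(Lagrange.basis T id j).eval x| ≤ M := by
        intro j
        obtain ⟨M, hM⟩ := hK.exists_bound_of_continuousOn
          (f := fun x => (Lagrange.basis T id j).eval x) (Polynomial.continuousOn _)
        exact ⟨|M|, abs_nonneg _, fun x hx => (hM x hx).trans (le_abs_self M)⟩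
      choose M hM0 hM using h1
      exact ⟨∑ j ∈ T, M j, fun j hj x hx => (hM j x hx).trans
        (Finset.single_le_sum (f := M) (fun i _ => hM0 i) hj)⟩
    obtain ⟨M, hM⟩ := hbd
    refine exists_uniform_bound_of_finite_expansion (T := T) (M := M)
      (e := fun j x => (Lagrange.basis T id j).eval x) hTK hM (fun n x _ => ?_) hL
    have hdeg : (P n).degree < T.card := by
      rw [hT]
      refine (Polynomial.degree_le_natDegree).trans_lt ?_
      exact_mod_cast Nat.lt_succ_of_le (hP n)
    conv_lhs => rw [Lagrange.eq_interpolate (s := T) (v := id) (Function.injective_id.injOn) hdeg,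
      Lagrange.interpolate_apply, Polynomial.eval_finsetSum]
    refine Finset.sum_congr rfl fun j _ => ?_
    simp [mul_comm]

/-! ### Transfer matrices and their discriminants. -/

theorem transferX_det {a b : ℕ → ℝ} (ha : ∀ n, 0 < a n) (x : ℝ) {n : ℕ} (hn : 1 ≤ n) (N : ℕ) :
    (transferX a b N n x).det = a (n - 1) / a (n + N - 1) := by
  induction N with
  | zero => simp [transferX, (ha (n - 1)).ne']
  | succ N ih =>
    have h1 := (ha (n + N - 1)).ne'
    have h2 := (ha (n + N)).ne'
    rw [transferX, Matrix.det_mul, ih, transferB, Matrix.det_fin_two_of,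
      show n + (N + 1) - 1 = n + N by omega]
    field_simp
    ring

theorem transferX_mulVec_genEigvec {a b : ℕ → ℝ} (ha : ∀ n, 0 < a n)
    (α : EuclideanSpace ℝ (Fin 2)) (x : ℝ) {n : ℕ} (hn : 1 ≤ n) (N : ℕ) :
    (transferX a b N n x).mulVec ![genEigvec a b α x (n - 1), genEigvec a b α x n] =
      ![genEigvec a b α x (n + N - 1), genEigvec a b α x (n + N)] := by
  induction N with
  | zero => simp [transferX]
  | succ N ih =>
    rw [transferX, ← Matrix.mulVec_mulVec, ih, transferB]
    obtain ⟨m, hm⟩ : ∃ m, n + N = m + 1 := ⟨n + N - 1, by omega⟩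
    have e2 : n + (N + 1) = m + 2 := by omega
    have h2 := (ha (m + 1)).ne'
    rw [e2, hm]
    ext j
    fin_cases j
    · simp [Matrix.mulVec, dotProduct, Fin.sum_univ_two]
    · simp [Matrix.mulVec, dotProduct, Fin.sum_univ_two, genEigvec]
      field_simp
      ring

theorem continuous_genEigvec (a b : ℕ → ℝ) (n : ℕ) :
    Continuous fun p : EuclideanSpace ℝ (Fin 2) × ℝ => genEigvec a b p.1 p.2 n := by
  have key : ∀ n, (Continuous fun p : EuclideanSpace ℝ (Fin 2) × ℝ => genEigvec a b p.1 p.2 n) ∧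
      Continuous fun p : EuclideanSpace ℝ (Fin 2) × ℝ => genEigvec a b p.1 p.2 (n + 1) := by
    intro n
    induction n with
    | zero => constructor <;> · simp only [genEigvec]; fun_prop
    | succ n ih =>
      refine ⟨ih.2, ?_⟩
      have h1 := ih.1
      have h2 := ih.2
      simp only [genEigvec]
      fun_prop
  exact (key n).1

theorem exists_polynomial_transferX (a b : ℕ → ℝ) (N n : ℕ) (i j : Fin 2) :
    ∃ P : Polynomial ℝ, P.natDegree ≤ N ∧ ∀ x, transferX a b N n x i j = P.eval x := by
  induction N generalizing i with
  | zero => exact ⟨Polynomial.C ((1 : Matrix (Fin 2) (Fin 2) ℝ) i j), by simp, by simp [transferX]⟩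
  | succ N ih =>
    obtain ⟨P, hP, hPx⟩ := ih 0
    obtain ⟨Q, hQ, hQx⟩ := ih 1
    fin_cases i
    · refine ⟨Q, by omega, fun x => ?_⟩
      simp [transferX, transferB, Matrix.mul_apply, Fin.sum_univ_two, ← hQx]
    · refine ⟨Polynomial.C (-(a (n + N - 1) / a (n + N))) * P +
        (Polynomial.C ((a (n + N))⁻¹) * (Polynomial.X - Polynomial.C (b (n + N)))) * Q, ?_,
        fun x => ?_⟩
      · refine Polynomial.natDegree_add_le_of_degree_le ?_ ?_
        · exact (Polynomial.natDegree_C_mul_le _ _).trans (by omega)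
        · refine Polynomial.natDegree_mul_le.trans ?_
          have := (Polynomial.natDegree_C_mul_le ((a (n + N))⁻¹)
            (Polynomial.X - Polynomial.C (b (n + N)))).trans (Polynomial.natDegree_X_sub_C_le _)
          omega
      · simp [transferX, transferB, Matrix.mul_apply, Fin.sum_univ_two, hPx, hQx,
          -mul_eq_mul_right_iff]
        ring

theorem discr_fin_two (M : Matrix (Fin 2) (Fin 2) ℝ) :
    M.discr = (M 0 0 - M 1 1) ^ 2 + 4 * (M 0 1 * M 1 0) := by
  rw [Matrix.discr_of_card_eq_two _ (by simp), Matrix.trace_fin_two, Matrix.det_fin_two]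
  ring

theorem exists_polynomial_discr_transferX (a b : ℕ → ℝ) (N n : ℕ) :
    ∃ P : Polynomial ℝ, P.natDegree ≤ 2 * N ∧ ∀ x, (transferX a b N n x).discr = P.eval x := by
  choose P hP hPx using exists_polynomial_transferX a b N n
  refine ⟨(P 0 0 - P 1 1) ^ 2 + Polynomial.C 4 * (P 0 1 * P 1 0), ?_, fun x => ?_⟩
  · refine Polynomial.natDegree_add_le_of_degree_le ?_ ?_
    · refine Polynomial.natDegree_pow_le_of_le 2 ?_
      simpa using Polynomial.natDegree_sub_le_of_le (hP 0 0) (hP 1 1)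
    · refine (Polynomial.natDegree_C_mul_le _ _).trans (Polynomial.natDegree_mul_le.trans ?_)
      linarith [hP 0 1, hP 1 0]
  · rw [discr_fin_two]
    simp [hPx]

theorem abs_entry_le_l2_opNorm (M : Matrix (Fin 2) (Fin 2) ℝ) (i j : Fin 2) : |M i j| ≤ ‖M‖ := by
  have h := Matrix.l2_opNorm_mulVec M (EuclideanSpace.single j 1)
  have h2 := EuclideanSpace.norm_eq (𝕜 := ℝ) (WithLp.toLp 2 (M.mulVec (Pi.single j 1)))
  refine le_trans ?_ (h.trans (by simp))
  refine le_trans (le_of_eq ?_) (PiLp.norm_apply_le _ i)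
  simp

/-! ### From the Stolz class to almost invariant sequences. -/

/-- With `b ^ r` the sum over `1 ≤ j ≤ r` of `‖Δ^j F‖ ^ (r / j)`, each summand is at most `b ^ r`,
so `‖Δ^j F‖ ≤ b ^ j`. One summable weight thus encodes all the conditions. -/
theorem MemStolz.exists_diffBound {r : ℕ} (hr : 1 ≤ r) {K : TopologicalSpace.Compacts ℝ}
    {F : ℕ → C(K, Matrix (Fin 2) (Fin 2) ℝ)} (h : MemStolz r 0 F) (m : ℕ) :
    ∃ b : ℕ → ℝ, (∀ n, 0 ≤ b n) ∧ (Summable fun n => b n ^ r) ∧ (∃ M, ∀ n, b n ≤ M) ∧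
      ∀ i j, DiffBound b 0 r (fun n (x : K) => ((F (n + m + 1) x i j : ℝ) : ℂ)) := by
  have hr0 : (0 : ℝ) < r := by exact_mod_cast hr
  set B : ℕ → ℝ := fun n =>
    ∑ j ∈ Finset.Icc 1 r, ‖stolzDiff j F (n + m + 1)‖ ^ ((r : ℝ) / j) with hB
  have hB0 : ∀ n, 0 ≤ B n := fun n => Finset.sum_nonneg fun j _ => by positivity
  have hBs : Summable B := by
    refine summable_sum fun j hj => ?_
    rw [Finset.mem_Icc] at hj
    have := (summable_nat_add_iff m).2 (h.summable j hj.1 (by omega))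
    simpa using this
  set b : ℕ → ℝ := fun n => B n ^ ((r : ℝ)⁻¹) with hb
  have hb0 : ∀ n, 0 ≤ b n := fun n => Real.rpow_nonneg (hB0 n) _
  have hbr : ∀ n, b n ^ r = B n := fun n => Real.rpow_inv_natCast_pow (hB0 n) (by omega)
  have hbd : ∀ s ≤ r, ∃ C : ℝ, ∀ n, ‖stolzDiff s F (n + m + 1)‖ ≤ C * b n ^ s := by
    intro s hs
    rcases Nat.eq_zero_or_pos s with rfl | hs0
    · obtain ⟨C, hC⟩ := h.bounded
      exact ⟨C, fun n => by simpa [stolzDiff] using hC (n + m + 1) (by omega)⟩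
    · refine ⟨1, fun n => ?_⟩
      have hs0' : (0 : ℝ) < s := by exact_mod_cast hs0
      have h1 : ‖stolzDiff s F (n + m + 1)‖ ^ ((r : ℝ) / s) ≤ B n :=
        Finset.single_le_sum (f := fun j => ‖stolzDiff j F (n + m + 1)‖ ^ ((r : ℝ) / j))
          (fun j _ => by positivity) (Finset.mem_Icc.2 ⟨hs0, hs⟩)
      have h2 := Real.rpow_le_rpow (by positivity) h1 (by positivity : 0 ≤ (s : ℝ) / r)
      rw [← Real.rpow_mul (norm_nonneg _), show (r : ℝ) / s * (s / r) = 1 by field_simp,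
        Real.rpow_one] at h2
      rw [one_mul, hb, ← Real.rpow_natCast, ← Real.rpow_mul (hB0 n)]
      rwa [show (r : ℝ)⁻¹ * s = s / r by ring]
  refine ⟨b, hb0, by simpa only [hbr] using hBs, ?_, fun i j => ?_⟩
  · obtain ⟨M, hM⟩ := hBs.tendsto_atTop_zero.bddAbove_range
    refine ⟨M ^ ((r : ℝ)⁻¹), fun n => ?_⟩
    have := hB0 n
    exact Real.rpow_le_rpow this (hM ⟨n, rfl⟩) (by positivity)
  · have hentry : ∀ s ≤ r, ∃ C : ℝ, ∀ n (x : K),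
        ‖((stolzDiff s F (n + m + 1) x i j : ℝ) : ℂ)‖ ≤ C * b n ^ s := by
      intro s hs
      obtain ⟨C, hC⟩ := hbd s hs
      refine ⟨C, fun n x => ?_⟩
      rw [Complex.norm_real]
      exact (abs_entry_le_l2_opNorm _ i j).trans ((ContinuousMap.norm_coe_le_norm _ x).trans (hC n))
    have key : ∀ d s, s + d = r → DiffBound b s d
        (fun n (x : K) => ((stolzDiff s F (n + m + 1) x i j : ℝ) : ℂ)) := by
      intro d
      induction d with
      | zero => exact fun s hs => hentry s (by omega)
      | succ d ih =>
        intro s hs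
        refine ⟨hentry s (by omega), ?_⟩
        convert ih (s + 1) (by omega) using 3 with n x
        have e : stolzDiff (s + 1) F (n + m + 1) =
            stolzDiff s F (n + 1 + m + 1) - stolzDiff s F (n + m + 1) := by
          rw [stolzDiff, show n + 1 + m + 1 = n + m + 1 + 1 by ring]
        have e' : stolzDiff (s + 1) F (n + m + 1) x i j =
            stolzDiff s F (n + 1 + m + 1) x i j - stolzDiff s F (n + m + 1) x i j := by
          rw [e]
          rfl
        rw [e', Complex.ofReal_sub]
    simpa [stolzDiff] using key r 0 (by omega)

theorem exists_approx_fixed_of_discr {X : Type*} {b : ℕ → ℝ} {M δ : ℝ} {r : ℕ} (hr : 1 ≤ r)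
    {p q u v : ℕ → X → ℝ} (hb : ∀ n, 0 ≤ b n) (hM : ∀ n, b n ≤ M) (hδ : 0 < δ)
    (hp : DiffBound b 0 r (fun n x => (p n x : ℂ)))
    (hq : DiffBound b 0 r (fun n x => (q n x : ℂ)))
    (hu : DiffBound b 0 r (fun n x => (u n x : ℂ)))
    (hv : DiffBound b 0 r (fun n x => (v n x : ℂ)))
    (hdiscr : ∀ n x, (p n x - v n x) ^ 2 + 4 * (q n x * u n x) ≤ -δ) :
    ∃ (t t₀ : ℕ → X → ℂ) (s : ℕ → X → ℝ) (C δ' : ℝ), 0 < δ' ∧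
      (∀ n x, s n x = √(-((p n x - v n x) ^ 2 + 4 * (q n x * u n x)))) ∧
      (∀ n x, |q n x| ≤ C) ∧ (∀ n x, |v n x| ≤ C) ∧ (∀ n x, |s n x| ≤ C) ∧
      (∀ n x, ‖t n x‖ ≤ C) ∧
      (∀ n x, ‖(u n x : ℂ) + t n x * v n x - t (n + 1) x * p n x -
        t n x * t (n + 1) x * q n x‖ ≤ C * b n ^ r) ∧
      (∀ n x, ‖t n x - t₀ n x‖ ≤ C * b n) ∧ (∀ n x, δ' ≤ |(t₀ n x).im|) ∧
      (∀ n x, 2 * q n x * (t₀ n x).re = v n x - p n x) ∧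
      (∀ n x, 2 * q n x * (t₀ n x).im = s n x) ∧
      (∀ n x, q n x * Complex.normSq (t₀ n x) = -u n x) := by
  set f : ℕ → X → ℝ := fun n x => -((p n x - v n x) ^ 2 + 4 * (q n x * u n x)) with hf
  have hfδ : ∀ n x, δ ≤ f n x := fun n x => by
    have := hdiscr n x
    simp only [hf]
    linarith
  have hfB : DiffBound b 0 r (fun n x => (f n x : ℂ)) := by
    have h1 := (hp.sub hv).mul hb hM (hp.sub hv)
    have h2 := (DiffBound.const_zero (b := b) (d := r) (X := X) 4).mul hb hM (hq.mul hb hM hu)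
    convert (h1.add h2).neg using 3
    simp only [hf]
    push_cast
    ring
  set s : ℕ → X → ℝ := fun n x => √(f n x) with hs
  have hsB : DiffBound b 0 r (fun n x => (s n x : ℂ)) := hfB.sqrt hb hM hδ hfδ
  have hsδ : ∀ n x, √δ ≤ s n x := fun n x => Real.sqrt_le_sqrt (hfδ n x)
  have hsq : ∀ n x, s n x ^ 2 = f n x := fun n x => Real.sq_sqrt (hδ.le.trans (hfδ n x))
  have hδs : 0 < √δ := Real.sqrt_pos.2 hδ
  obtain ⟨Cu, hCu0, hCu⟩ := hu.bound_pos hb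
  obtain ⟨Cq, hCq0, hCq⟩ := hq.bound_pos hb
  obtain ⟨Cv, -, hCv⟩ := hv.bound_pos hb
  obtain ⟨Cs, -, hCs⟩ := hsB.bound_pos hb
  simp only [Complex.norm_real, Real.norm_eq_abs, pow_zero, mul_one] at hCu hCq hCv hCs
  -- Negative discriminant forces `4 q u ≤ -δ`; as `u` is bounded, `q` is bounded away from zero.
  have hqδ : ∀ n x, δ / (4 * Cu) ≤ |q n x| := by
    intro n x
    rw [div_le_iff₀ (by positivity)]
    have h1 : δ ≤ 4 * |q n x * u n x| := by
      nlinarith [hdiscr n x, sq_nonneg (p n x - v n x), neg_abs_le (q n x * u n x)]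
    rw [abs_mul] at h1
    nlinarith [mul_le_mul_of_nonneg_left (hCu n x) (abs_nonneg (q n x))]
  have hq0 : ∀ n x, q n x ≠ 0 := fun n x =>
    abs_pos.1 ((by positivity : 0 < δ / (4 * Cu)).trans_le (hqδ n x))
  have hs0 : ∀ n x, s n x ≠ 0 := fun n x => (hδs.trans_le (hsδ n x)).ne'
  have hqi : DiffBound b 0 r (fun n x => ((q n x : ℂ))⁻¹) :=
    hq.inv hb hM (by positivity : 0 < δ / (4 * Cu)) fun n x => by simpa using hqδ n x
  have hsi : DiffBound b 0 r (fun n x => ((s n x : ℂ))⁻¹) :=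
    hsB.inv hb hM hδs fun n x => by simpa using (hsδ n x).trans (le_abs_self _)
  have hI : DiffBound b 0 r (fun _ (_ : X) => Complex.I) := DiffBound.const_zero _
  have hh : DiffBound b 0 r (fun _ (_ : X) => (1 / 2 : ℂ)) := DiffBound.const_zero _
  set t₀ : ℕ → X → ℂ := fun n x =>
    1 / 2 * (((v n x : ℂ) - p n x + Complex.I * s n x) * (q n x : ℂ)⁻¹) with ht₀
  have ht₀B : DiffBound b 0 r t₀ :=
    hh.mul hb hM (((hv.sub hp).add (hI.mul hb hM hsB)).mul hb hM hqi)
  have hqt : ∀ n x, 2 * (q n x : ℂ) * t₀ n x = v n x - p n x + Complex.I * s n x := by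
    intro n x
    have : (q n x : ℂ) ≠ 0 := by exact_mod_cast hq0 n x
    simp only [ht₀]
    field_simp
  have hre : ∀ n x, 2 * q n x * (t₀ n x).re = v n x - p n x := by
    intro n x
    have := congrArg Complex.re (hqt n x)
    simpa using this
  have him : ∀ n x, 2 * q n x * (t₀ n x).im = s n x := by
    intro n x
    have := congrArg Complex.im (hqt n x)
    simpa using this
  -- The derivative `v - p - 2 t₀ q` equals `-I s`, whose inverse is `I / s`.
  have hD : DiffBound b 0 r (fun n x => Complex.I * (s n x : ℂ)⁻¹) := hI.mul hb hM hsi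
  obtain ⟨t, h1, h2⟩ := DiffBound.exists_approx_fixed (u := fun n x => (u n x : ℂ))
    (v := fun n x => (v n x : ℂ)) hb hM hp hq
    ht₀B hD (fun n x => by
      have h3 : (2 * (q n x : ℂ) * t₀ n x - (v n x - p n x)) ^ 2 =
          (v n x - p n x) ^ 2 + 4 * (q n x * u n x) := by
        have h4 : ((s n x : ℂ)) ^ 2 = -((p n x - v n x) ^ 2 + 4 * (q n x * u n x)) := by
          exact_mod_cast hsq n x
        rw [hqt]
        linear_combination (-1 : ℂ) * h4 + (s n x : ℂ) ^ 2 * Complex.I_sq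
      have hq' : (q n x : ℂ) ≠ 0 := by exact_mod_cast hq0 n x
      refine mul_left_cancel₀ (mul_ne_zero (by norm_num : (4 : ℂ) ≠ 0) hq') ?_
      linear_combination -h3)
    (fun n x => by
      have hs' : (s n x : ℂ) ≠ 0 := by exact_mod_cast hs0 n x
      have h3 : (v n x : ℂ) - p n x - 2 * t₀ n x * q n x = -(Complex.I * s n x) := by
        linear_combination -hqt n x
      rw [h3]
      field_simp
      linear_combination -Complex.I_sq) (r - 1) (by omega)
  -- Taking `r - 1` corrections uses up all available differences and brings the residual to order
  -- `b ^ r`.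
  rw [show r - 1 - (r - 1) = 0 by omega] at h1 h2
  rw [show r - 1 + 1 = r by omega] at h2
  have htB : DiffBound b 0 0 t := by
    convert (h1.lower hb hM).add (ht₀B.mono_depth (Nat.zero_le r)) using 3
    ring
  obtain ⟨C₁, hC₁⟩ := h1.bound
  obtain ⟨C₂, hC₂⟩ := h2.bound
  obtain ⟨C₃, hC₃⟩ := htB.bound
  simp only [pow_zero, mul_one, pow_one] at hC₁ hC₃
  obtain ⟨C, hqC, hvC, hsC, h₁C, h₂C, h₃C⟩ :
      ∃ C, Cq ≤ C ∧ Cv ≤ C ∧ Cs ≤ C ∧ C₁ ≤ C ∧ C₂ ≤ C ∧ C₃ ≤ C :=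
    ⟨max (max (max Cq Cv) Cs) (max (max C₁ C₂) C₃), by simp⟩
  refine ⟨t, t₀, s, C, √δ / (2 * Cq), by positivity,
    fun _ _ => rfl, fun n x => (hCq n x).trans hqC, fun n x => (hCv n x).trans hvC,
    fun n x => (hCs n x).trans hsC, fun n x => (hC₃ n x).trans h₃C,
    fun n x => (hC₂ n x).trans (mul_le_mul_of_nonneg_right h₂C (pow_nonneg (hb n) r)),
    fun n x => (hC₁ n x).trans (mul_le_mul_of_nonneg_right h₁C (hb n)),
    fun n x => ?_, hre, him, fun n x => ?_⟩
  · rw [div_le_iff₀ (by positivity)]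
    calc √δ ≤ |2 * q n x * (t₀ n x).im| := by
          rw [him]
          exact (hsδ n x).trans (le_abs_self _)
      _ = |(t₀ n x).im| * (2 * |q n x|) := by
          rw [abs_mul, abs_mul, abs_two]
          ring
      _ ≤ _ := by
          gcongr
          exact hCq n x
  · refine mul_left_cancel₀ (mul_ne_zero (four_ne_zero' ℝ) (hq0 n x)) ?_
    have h3 := hsq n x
    simp only [hf, ← him] at h3
    rw [Complex.normSq_apply]
    linear_combination h3 + (2 * q n x * (t₀ n x).re + (v n x - p n x)) * hre n x

/-! ### Assembly of the proof. -/

theorem abs_sqrt_sub_sqrt_le (x y : ℝ) : |√x - √y| ≤ √|x - y| := by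
  have key : ∀ x y : ℝ, √x - √y ≤ √|x - y| := by
    intro x y
    rw [sub_le_iff_le_add]
    refine Real.sqrt_le_iff.2 ⟨by positivity, ?_⟩
    have h1 := Real.sq_sqrt (abs_nonneg (x - y))
    have h2 : y ≤ √y ^ 2 := by
      rcases le_total 0 y with hy | hy
      · exact (Real.sq_sqrt hy).ge
      · exact hy.trans (sq_nonneg _)
    nlinarith [le_abs_self (x - y), mul_nonneg (Real.sqrt_nonneg |x - y|) (Real.sqrt_nonneg y)]
  rw [abs_le]
  refine ⟨?_, key x y⟩
  have := key y x
  rw [abs_sub_comm] at this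
  linarith

theorem turanDet_eq_form {a b : ℕ → ℝ} (ha : ∀ n, 0 < a n) {N n : ℕ} (hn : 1 ≤ n)
    (α : EuclideanSpace ℝ (Fin 2)) (x : ℝ) :
    turanDet a b N n α x = a (n + N - 1) *
      (transferX a b N n x 0 1 * genEigvec a b α x n ^ 2 +
        (transferX a b N n x 0 0 - transferX a b N n x 1 1) * genEigvec a b α x (n - 1) *
          genEigvec a b α x n - transferX a b N n x 1 0 * genEigvec a b α x (n - 1) ^ 2) := by
  have h := transferX_mulVec_genEigvec (b := b) ha α x hn N
  have h0 := congrFun h 0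
  have h1 := congrFun h 1
  simp only [Matrix.mulVec, dotProduct, Fin.sum_univ_two, Matrix.cons_val_zero,
    Matrix.cons_val_one] at h0 h1
  rw [turanDet, ← h0, ← h1]
  ring

/-- Uniform convergence makes the limit continuous on `K`, and a negative continuous function on a
compact set is bounded away from zero. -/
theorem exists_uniform_discr_limit {a b : ℕ → ℝ} {N i : ℕ} {K : TopologicalSpace.Compacts ℝ}
    (hK : (K : Set ℝ) ⊆ turanLambda a b N i) :
    ∃ (L : ℝ → ℝ) (κ : ℕ → ℝ) (δ : ℝ), 0 < δ ∧ Tendsto κ atTop (𝓝 0) ∧ (∀ x ∈ K, L x ≤ -δ) ∧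
      ∀ k, ∀ x ∈ K, |(transferX a b N (k * N + i) x).discr - L x| ≤ κ k := by
  have hL : ∀ x : ℝ, ∃ l : ℝ, x ∈ K → l < 0 ∧
      Tendsto (fun k : ℕ => (transferX a b N (k * N + i) x).discr) atTop (𝓝 l) := by
    intro x
    by_cases hx : x ∈ K
    · obtain ⟨l, hl⟩ := hK hx
      exact ⟨l, fun _ => hl⟩
    · exact ⟨0, fun h => (hx h).elim⟩
  choose L hL using hL
  choose P hP hPx using fun k : ℕ => exists_polynomial_discr_transferX a b N (k * N + i)
  obtain ⟨κ, hκ, hκL⟩ := exists_uniform_bound_of_polynomial hP K.isCompact (L := L)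
    (fun x hx => by simpa only [hPx] using (hL x hx).2)
  have hunif : TendstoUniformlyOn (fun k x => (P k).eval x) L atTop (K : Set ℝ) := by
    rw [Metric.tendstoUniformlyOn_iff]
    intro ε hε
    filter_upwards [hκ.eventually_lt_const hε] with k hk x hx
    rw [dist_comm, Real.dist_eq]
    exact (hκL k x hx).trans_lt hk
  have hcont : ContinuousOn L K :=
    hunif.continuousOn (Frequently.of_forall fun k => (P k).continuousOn)
  obtain ⟨δ, hδ, hLδ⟩ : ∃ δ > 0, ∀ x ∈ K, L x ≤ -δ := by
    rcases (K : Set ℝ).eq_empty_or_nonempty with hE | hne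
    · refine ⟨1, one_pos, fun x hx => ?_⟩
      have : x ∈ (K : Set ℝ) := hx
      simp [hE] at this
    · obtain ⟨x₀, hx₀, hmax⟩ := K.isCompact.exists_isMaxOn hne hcont
      exact ⟨-L x₀, neg_pos.2 (hL x₀ hx₀).1, fun x hx => by simpa using hmax hx⟩
  exact ⟨L, κ, δ, hδ, hκ, hLδ, fun k x hx => by simpa only [hPx] using hκL k x hx⟩

theorem theorem1 (a b : ℕ → ℝ) (ha : ∀ n : ℕ, 0 < a n) (N r i : ℕ) (hN : 1 ≤ N) (hr : 1 ≤ r)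
    (hi : i < N) (K : TopologicalSpace.Compacts ℝ) (hK : (K : Set ℝ) ⊆ turanLambda a b N i)
    (hlim : Tendsto (fun k : ℕ => a ((k + 1) * N + i - 1) / a (k * N + i - 1)) atTop (𝓝 1))
    (hX : MemStolzGL r 0 K (fun k : ℕ => transferX a b N (k * N + i))) :
    ∃ g : EuclideanSpace ℝ (Fin 2) × ℝ → ℝ,
      TendstoUniformlyOn
        (fun (k : ℕ) (p : EuclideanSpace ℝ (Fin 2) × ℝ) => turanDet a b N (k * N + i) p.1 p.2)
        g atTop (Metric.sphere (0 : EuclideanSpace ℝ (Fin 2)) 1 ×ˢ (K : Set ℝ)) := by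
  obtain ⟨L, κ, δ, hδ, hκ, hLδ, hκL⟩ := exists_uniform_discr_limit hK
  obtain ⟨m, hm⟩ := eventually_atTop.1 (hκ.eventually_le_const (half_pos hδ))
  obtain ⟨F, hF, hS⟩ := hX
  obtain ⟨β, hβ, hβr, ⟨M, hM⟩, hB⟩ := hS.exists_diffBound hr m
  -- Starting at `k = m + 1` keeps the discriminants below `-δ / 2` and the index positive, as the
  -- Stolz class requires.
  set Y : ℕ → K → Matrix (Fin 2) (Fin 2) ℝ := fun n x =>
    transferX a b N ((n + m + 1) * N + i) x with hY
  have hYB : ∀ j l, DiffBound β 0 r (fun n (x : K) => ((Y n x j l : ℝ) : ℂ)) := by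
    intro j l
    convert hB j l using 6 with n x
    exact congrFun (congrFun (hF (n + m + 1) (by omega) x).1.symm j) l
  have hdisc : ∀ n x, (Y n x).discr =
      (Y n x 0 0 - Y n x 1 1) ^ 2 + 4 * (Y n x 0 1 * Y n x 1 0) := fun n x => discr_fin_two _
  obtain ⟨t, t₀, s, C, δ', hδ', hs, hqC, hvC, hsC, htC, hR, htt, htδ, hre, him, hsq⟩ :=
    exists_approx_fixed_of_discr hr hβ hM (half_pos hδ) (hYB 0 0) (hYB 0 1) (hYB 1 0) (hYB 1 1)
      (fun n x => by
        rw [← hdisc]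
        have h1 := hκL (n + m + 1) x x.2
        have h2 := hm (n + m + 1) (by omega)
        have h3 := hLδ x x.2
        have h4 := (abs_le.1 h1).2
        simp only [hY]
        linarith)
  set E := Metric.sphere (0 : EuclideanSpace ℝ (Fin 2)) 1 ×ˢ (K : Set ℝ) with hE
  have hEc : IsCompact E := (isCompact_sphere _ _).prod K.isCompact
  have hpos : ∀ n, 1 ≤ (n + m + 1) * N + i := fun n => by nlinarith
  have hidx : ∀ n, (n + 1 + m + 1) * N + i = (n + m + 1) * N + i + N := fun n => by ring
  have hvec := fun n (y : E) =>
    transferX_mulVec_genEigvec (b := b) ha y.1.1 y.1.2 (hpos n) N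
  have hbdd : ∀ n, ∃ H, ∀ y : E, |genEigvec a b y.1.1 y.1.2 n| ≤ H := by
    intro n
    obtain ⟨H, hH⟩ := hEc.exists_bound_of_continuousOn (continuous_genEigvec a b n).continuousOn
    exact ⟨H, fun y => hH y.1 y.2⟩
  -- The matrices depend on `x` only; `π` pulls them back to pairs `(α, x)`, over which the solution
  -- is uniformly bounded at each index by compactness.
  set π : E → K := fun y => ⟨y.1.2, y.2.2⟩ with hπ
  obtain ⟨g, ε, k, hε, hg⟩ := exists_uniform_limit_turan_form (Y := E) hr
    (A := fun n => a ((n + m + 1) * N + i - 1))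
    (p := fun n y => Y n (π y) 0 0) (q := fun n y => Y n (π y) 0 1)
    (u := fun n y => Y n (π y) 1 0) (v := fun n y => Y n (π y) 1 1)
    (w₁ := fun n y => genEigvec a b y.1.1 y.1.2 ((n + m + 1) * N + i - 1))
    (w₂ := fun n y => genEigvec a b y.1.1 y.1.2 ((n + m + 1) * N + i))
    (s := fun n y => s n (π y)) (t := fun n y => t n (π y)) (t₀ := fun n y => t₀ n (π y))
    (σ := fun y => √(-L y.1.2)) (κ := fun n => √(κ (n + m + 1)))
    (fun n => ha _)
    (by
      have := (tendsto_add_atTop_iff_nat (m + 1)).2 hlim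
      refine this.congr fun n => ?_
      rw [show n + 1 + m + 1 = n + (m + 1) + 1 by ring, show n + m + 1 = n + (m + 1) by ring])
    hβ hβr
    (fun n y => by
      have h := transferX_det (b := b) ha y.1.2 (hpos n) N
      rw [Matrix.det_fin_two] at h
      simp only [hY, hπ]
      rw [h, hidx, mul_div_cancel₀ _ (ha _).ne'])
    (fun n y => by
      have h := congrFun (hvec n y) 0
      simp only [Matrix.mulVec, dotProduct, Fin.sum_univ_two, Matrix.cons_val_zero,
        Matrix.cons_val_one] at h
      rw [hidx, ← h])
    (fun n y => by
      have h := congrFun (hvec n y) 1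
      simp only [Matrix.mulVec, dotProduct, Fin.sum_univ_two, Matrix.cons_val_zero,
        Matrix.cons_val_one] at h
      rw [hidx, ← h])
    (fun n y => hqC n _) (fun n y => hvC n _) (fun n y => hsC n _) (fun n y => htC n _)
    (fun n y => hR n _) (fun n y => htt n _) hδ' (fun n y => htδ n _) (fun n y => hre n _)
    (fun n y => him n _) (fun n y => hsq n _)
    (by simpa [add_assoc] using ((tendsto_add_atTop_iff_nat (m + 1)).2 hκ).sqrt)
    (fun n y => by
      simp only [hs, ← hdisc]
      refine (abs_sqrt_sub_sqrt_le _ _).trans (Real.sqrt_le_sqrt ?_)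
      rw [← abs_neg]
      convert hκL (n + m + 1) y.1.2 y.2.2 using 2
      simp only [hY, hπ]
      ring)
    (fun n => by
      obtain ⟨H₁, h₁⟩ := hbdd ((n + m + 1) * N + i - 1)
      obtain ⟨H₂, h₂⟩ := hbdd ((n + m + 1) * N + i)
      exact ⟨max H₁ H₂, fun y => ⟨(h₁ y).trans (le_max_left _ _), (h₂ y).trans (le_max_right _ _)⟩⟩)
  classical
  refine ⟨fun y => if hy : y ∈ E then g ⟨y, hy⟩ else 0, ?_⟩
  rw [Metric.tendstoUniformlyOn_iff]
  intro η hη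
  obtain ⟨n₀, hn₀⟩ := eventually_atTop.1 (hε.eventually_lt_const hη)
  filter_upwards [eventually_ge_atTop (n₀ + k + m + 1)] with n hn y hy
  -- Undoes both shifts: `m + 1` from the choice of `Y` and `k` from the limit of the form.
  obtain ⟨l, rfl⟩ : ∃ l, n = l + k + m + 1 := ⟨n - k - m - 1, by omega⟩
  have h := hg l ⟨y, hy⟩
  rw [dist_comm, Real.dist_eq, dif_pos hy, turanDet_eq_form ha (hpos (l + k)), ← hidx]
  exact h.trans_lt (hn₀ l (by omega))
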